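/- Let $\mathbb S=\{z\in\mathbb C:|z|=1\}$ and $\mathbb S_+=\{z\in\mathbb S:\operatorname{Re}z\ge 0\}$. For an abelian group $G$, let $G^*$ be the group of all homomorphisms $G\to\mathbb S$ (written additively); if $G$ carries a topology, let $\widehat G\subseteq G^*$ be the subgroup of continuous characters. A subset $A$ of an abelian topological group $G$ is quasi-convex if for every $g\in G\setminus A$ there is $\chi\in\widehat G$ with $\chi(g)\notin\mathbb S_+$ and $\chi(A)\subseteq\mathbb S_+$; $G$ is locally quasi-convex if it has a neighborhood base at zero of quasi-convex sets. Two topologies on $G$ are compatible if they have the same continuous characters. A locally quasi-convex abelian group $(G,\tau)$ is a Mackey group if every locally quasi-convex group topology on $G$ compatible with $\tau$ is coarser than or equal to $\tau$. For an abelian topological group $G$ whose continuous characters separate points, let $\operatorname{Mac}(G)$ be the family of all $K\subseteq\widehat G$ that are compact and quasi-convex in $(\widehat G,\sigma(\widehat G,G))$, where $\sigma(\widehat G,G)$ is the topology of pointwise convergence, and such that for every integer $n\ge1$ and every finite $F\subseteq\widehat G$ with $0\in F$, every $\eta\in G^*$ with $\eta\big(\{g\in G:\chi(g)\in\mathbb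 S_+\text{ for all }\chi\in (n)K+F\}\big)\subseteq\mathbb S_+$ is continuous; here $(n)K=K+\dots+K$ ($n$ summands). Let $E$ be a real normed space, regarded as an abelian topological group under addition with its norm topology, let $E'$ be its dual Banach space, and let $\psi:E'\to\widehat E$, $\psi(\chi)(x)=\exp(2\pi i\,\chi(x))$. Then $E$ is a Mackey group if and only if, for every $C\in\operatorname{Mac}(E)$, the set $\psi^{-1}(C)$ is norm-bounded in $E'$. -/

import Mathlib

open scoped Pointwise Topology

noncomputable section

namespace MackeyGroup

/-- The right half `𝕊₊ = {z ∈ 𝕊 : Re z ≥ 0}` of the unit circle. -/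
def circlePos : Set Circle := {z | 0 ≤ (z : ℂ).re}

/-- The dual group `Ĝ` of `(G, t)`: the continuous characters, as a subgroup of the group
`G* = AddChar G Circle` of all characters of `G` (group operation written additively). -/
def dualGroup {G : Type*} [AddCommGroup G] (t : TopologicalSpace G) :
    AddSubgroup (AddChar G Circle) where
  carrier := {χ | Continuous[t, _] (fun g : G => χ g)}
  add_mem' {χ η} hχ hη := by
    let _ := t
    have hχ' : Continuous (fun g : G => χ g) := hχ
    have hη' : Continuous (fun g : G => η g) := hη
    change Continuous (fun g : G => (χ + η) g)
    simp only [AddChar.add_apply]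
    exact hχ'.mul hη'
  zero_mem' := by
    let _ := t
    change Continuous (fun g : G => (0 : AddChar G Circle) g)
    simpa only [AddChar.zero_apply] using continuous_const
  neg_mem' {χ} hχ := by
    let _ := t
    have hχ' : Continuous (fun g : G => χ g) := hχ
    change Continuous (fun g : G => (-χ) g)
    simp only [AddChar.neg_apply']
    exact hχ'.inv

/-- The weak* topology `σ(Ĝ, G)` on `Ĝ`: the weakest topology making all evaluations
`χ ↦ χ g`, `g ∈ G`, continuous, that is, the topology of pointwise convergence. -/
abbrev weakStar {G : Type*} [AddCommGroup G] (t : TopologicalSpace G) :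
    TopologicalSpace (dualGroup t) :=
  ⨅ g : G, TopologicalSpace.induced (fun χ : dualGroup t => (χ : AddChar G Circle) g) inferInstance

/-- A subset `A` of `(G, t)` is quasi-convex if every point outside `A` can be separated from `A`
by a continuous character. -/
def IsQuasiConvex {G : Type*} [AddCommGroup G] (t : TopologicalSpace G) (A : Set G) : Prop :=
  ∀ g ∉ A, ∃ χ ∈ dualGroup t, χ g ∉ circlePos ∧ ∀ a ∈ A, χ a ∈ circlePos

/-- `t` is a locally quasi-convex group topology on `G`: a group topology having a neighborhood
base at zero that consists of quasi-convex sets. -/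
def IsLQC {G : Type*} [AddCommGroup G] (t : TopologicalSpace G) : Prop :=
  @IsTopologicalAddGroup G t _ ∧
    ∀ U ∈ @nhds G t 0, ∃ V ∈ @nhds G t 0, IsQuasiConvex t V ∧ V ⊆ U

/-- Two topologies on `G` are compatible if they have the same continuous characters. -/
def Compatible {G : Type*} [AddCommGroup G] (t₁ t₂ : TopologicalSpace G) : Prop :=
  dualGroup t₁ = dualGroup t₂

/-- `(G, t)` is a Mackey group: it is locally quasi-convex, and `t` is finer than every locally
quasi-convex group topology on `G` compatible with `t`. (In Mathlib's order on topologies,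
`t ≤ ν` means that `t` is finer than `ν`.) -/
def IsMackeyGroup {G : Type*} [AddCommGroup G] (t : TopologicalSpace G) : Prop :=
  IsLQC t ∧ ∀ ν : TopologicalSpace G, IsLQC ν → Compatible ν t → t ≤ ν

/-- The `n`-fold sumset `(n)A = A + ⋯ + A`. -/
def nfold {H : Type*} [AddCommGroup H] (A : Set H) : ℕ → Set H
  | 0 => {0}
  | n + 1 => nfold A n + A

/-- The inverse polar in `G` of a set `B ⊆ Ĝ`. -/
def invPolar {G : Type*} [AddCommGroup G] {t : TopologicalSpace G} (B : Set (dualGroup t)) :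
    Set G :=
  {g | ∀ χ ∈ B, (χ : AddChar G Circle) g ∈ circlePos}

/-- The polar of `A ⊆ G` in the group `G*` of all (not necessarily continuous) characters. -/
def fullPolar {G : Type*} [AddCommGroup G] (A : Set G) : Set (AddChar G Circle) :=
  {χ | ∀ a ∈ A, χ a ∈ circlePos}

/-- The family `Mac(G)` of all quasi-convex compact subsets `K` of `(Ĝ, σ(Ĝ, G))` such that for
every finite `F ⊆ Ĝ` containing zero and every `n ≥ 1`, all characters in the polar in `G*` of the
inverse polar of `(n)K + F` are continuous. -/
def Mac {G : Type*} [AddCommGroup G] (t : TopologicalSpace G) : Set (Set (dualGroup t)) :=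
  {K | IsQuasiConvex (weakStar t) K ∧ @IsCompact _ (weakStar t) K ∧
    ∀ F : Set (dualGroup t), F.Finite → 0 ∈ F → ∀ n : ℕ, 1 ≤ n →
      fullPolar (invPolar (nfold K n + F)) ⊆ (dualGroup t : Set (AddChar G Circle))}

/-- The norm topology of a normed space. -/
abbrev normTopology (E : Type*) [NormedAddCommGroup E] : TopologicalSpace E :=
  UniformSpace.toTopologicalSpace

/-- The canonical map `ψ : E' → Ê`, `ψ(χ)(x) = exp(2πi χ(x))`. -/
def psi (E : Type*) [NormedAddCommGroup E] [NormedSpace ℝ E] (χ : StrongDual ℝ E) :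
    dualGroup (normTopology E) :=
  ⟨Real.fourierChar.compAddMonoidHom ((χ : E →ₗ[ℝ] ℝ) : E →+ ℝ),
    Real.continuous_fourierChar.comp χ.continuous⟩

end MackeyGroup

end

noncomputable section

namespace MackeyGroup

open Real

/-! A locally quasi-convex group is Mackey exactly when every `C` in `Mac` has an inverse polar that
is a neighborhood of zero. If the group is Mackey, the inverse polars of the sets `(n)C + F` form a
base at zero of a locally quasi-convex group topology (`macBasis`). The last clause of `Mac` makes
it compatible, so it is coarser than the given one. Conversely, in a compatible locally quasi-convex
topology, the polar of a quasi-convex neighborhood `V` lies in `Mac` (`polar_mem_Mac`), and its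
inverse polar is contained in `V`. For a normed space, characters lift to functionals
(`psi_surjective`), and the neighborhood condition becomes norm-boundedness
(`isBounded_preimage_psi_iff`). -/

/-- The closed arc of half-length `ε` around `1` in the unit circle. -/
def arc (ε : ℝ) : Set Circle := Circle.exp '' Set.Icc (-ε) ε

/-! ### Arcs of the circle -/

lemma exp_mem_circlePos {θ : ℝ} : Circle.exp θ ∈ circlePos ↔ 0 ≤ cos θ := by
  simp [circlePos, Circle.coe_exp, Complex.exp_ofReal_mul_I_re]

lemma one_mem_circlePos : (1 : Circle) ∈ circlePos := by simp [circlePos]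

lemma inv_mem_circlePos {z : Circle} (hz : z ∈ circlePos) : z⁻¹ ∈ circlePos := by
  simpa [circlePos, Circle.coe_inv_eq_conj] using hz

lemma isClosed_circlePos : IsClosed circlePos :=
  isClosed_le continuous_const (Complex.continuous_re.comp continuous_subtype_val)

lemma arc_mul_mem {a b : ℝ} {z w : Circle} (hz : z ∈ arc a) (hw : w ∈ arc b) :
    z * w ∈ arc (a + b) := by
  obtain ⟨s, hs, rfl⟩ := hz
  obtain ⟨t, ht, rfl⟩ := hw
  exact ⟨s + t, ⟨by linarith [hs.1, ht.1], by linarith [hs.2, ht.2]⟩, Circle.exp_add s t⟩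

lemma one_mem_arc {a : ℝ} (ha : 0 ≤ a) : (1 : Circle) ∈ arc a :=
  ⟨0, ⟨by linarith, ha⟩, Circle.exp_zero⟩

lemma arc_mono {a b : ℝ} (h : a ≤ b) : arc a ⊆ arc b :=
  Set.image_mono (Set.Icc_subset_Icc (by linarith) h)

lemma arc_pi_div_two_subset : arc (π / 2) ⊆ circlePos := by
  rintro _ ⟨θ, hθ, rfl⟩
  exact exp_mem_circlePos.2 (cos_nonneg_of_mem_Icc ⟨by linarith [hθ.1], hθ.2⟩)

lemma abs_le_of_cos_nonneg {θ : ℝ} (h : |θ| ≤ π) (hc : 0 ≤ cos θ) : |θ| ≤ π / 2 := by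
  by_contra! hlt
  rw [← cos_abs] at hc
  exact absurd (cos_neg_of_pi_div_two_lt_of_lt hlt (by linarith [pi_pos])) (not_lt.2 hc)

/-- If the first `n` powers of `z` lie in the right half circle then `z` lies in a short arc. -/
lemma mem_arc_of_pow_mem {n : ℕ} (hn : 1 ≤ n) {z : Circle}
    (h : ∀ k, 1 ≤ k → k ≤ n → z ^ k ∈ circlePos) : z ∈ arc (π / (2 * n)) := by
  suffices H : |Complex.arg z| ≤ π / (2 * n) from ⟨_, abs_le.1 H, Circle.exp_arg z⟩
  have hpow : ∀ k, 1 ≤ k → k ≤ n → 0 ≤ cos (k * Complex.arg z) := by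
    intro k h1 hk
    have := h k h1 hk
    rw [← Circle.exp_arg z, ← Circle.exp_natCast_mul] at this
    exact exp_mem_circlePos.1 this
  induction n, hn using Nat.le_induction with
  | base =>
    have := abs_le_of_cos_nonneg (Complex.abs_arg_le_pi z) (by simpa using hpow 1 le_rfl le_rfl)
    simpa using this
  | succ n hn ih =>
    have ih := ih (fun k h1 hk => h k h1 (by omega)) (fun k h1 hk => hpow k h1 (by omega))
    have hn' : (1 : ℝ) ≤ n := by exact_mod_cast hn
    have hc := hpow (n + 1) (by omega) le_rfl
    have habs : |((n + 1 : ℕ) : ℝ) * Complex.arg z| = (n + 1) * |Complex.arg z| := by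
      rw [abs_mul, abs_of_nonneg (by positivity)]; push_cast; rfl
    rw [le_div_iff₀ (by positivity)] at ih
    -- The bound for `n` gives `(n + 1)|arg z| ≤ 2n|arg z| ≤ π`, so the angle has not wrapped
    -- around.
    have := abs_le_of_cos_nonneg (by rw [habs]; nlinarith [abs_nonneg (Complex.arg z)]) hc
    rw [habs] at this
    rw [le_div_iff₀ (by positivity)]
    push_cast
    linarith

lemma exists_arc_subset {N : Set Circle} (hN : N ∈ 𝓝 (1 : Circle)) :
    ∃ n : ℕ, 1 ≤ n ∧ arc (π / (2 * n)) ⊆ N := by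
  have hc : Circle.exp ⁻¹' N ∈ 𝓝 (0 : ℝ) :=
    Circle.exp.continuous.continuousAt.preimage_mem_nhds (by simpa using hN)
  obtain ⟨ε, hε, hsub⟩ := Metric.mem_nhds_iff.1 hc
  obtain ⟨n, hn⟩ := exists_nat_gt (π / (2 * ε))
  have hn0 : (0 : ℝ) < n := lt_trans (by positivity) hn
  refine ⟨n, by exact_mod_cast hn0, ?_⟩
  rintro _ ⟨θ, hθ, rfl⟩
  apply hsub
  rw [mem_ball_zero_iff, Real.norm_eq_abs]
  refine (abs_le.2 hθ).trans_lt ?_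
  rw [div_lt_iff₀ (by positivity)] at hn ⊢
  linarith

/-! ### Continuity of characters, polars and membership in `Mac` -/

section Characters

variable {G : Type*} [AddCommGroup G]

/-- The characters mapping a fixed neighborhood of zero into the right half circle are
equicontinuous. -/
lemma exists_nhds_forall_mem_arc [TopologicalSpace G] [IsTopologicalAddGroup G] {U : Set G}
    (hU : U ∈ 𝓝 (0 : G)) {n : ℕ} (hn : 1 ≤ n) :
    ∃ V ∈ 𝓝 (0 : G), ∀ χ : AddChar G Circle, (∀ u ∈ U, χ u ∈ circlePos) →
      ∀ v ∈ V, χ v ∈ arc (π / (2 * n)) := by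
  -- Since `χ (k • v) = χ v ^ k`, this `V` puts the first `n` powers of `χ v` in the half circle.
  refine ⟨⋂ k ∈ Finset.Icc 1 n, (fun x : G => k • x) ⁻¹' U, ?_, ?_⟩
  · rw [Filter.biInter_finset_mem]
    intro k _
    exact (continuous_nsmul k).continuousAt.preimage_mem_nhds (by simpa using hU)
  · intro χ hχ v hv
    refine mem_arc_of_pow_mem hn fun k h1 hk => ?_
    rw [← AddChar.map_nsmul_eq_pow]
    exact hχ _ (Set.mem_iInter₂.1 hv k (Finset.mem_Icc.2 ⟨h1, hk⟩))

/-- Smaller neighborhoods force values into arbitrarily short arcs, which is continuity at zero;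
translation does the rest. -/
lemma mem_dualGroup_of_nhds {t : TopologicalSpace G} (ht : @IsTopologicalAddGroup G t _)
    {U : Set G} (hU : U ∈ @nhds G t 0) {χ : AddChar G Circle}
    (hχ : ∀ u ∈ U, χ u ∈ circlePos) : χ ∈ dualGroup t := by
  let _ := t
  have h0 : Filter.Tendsto (fun g => χ g) (𝓝 0) (𝓝 1) := by
    refine fun N hN => Filter.mem_map.2 ?_
    obtain ⟨n, hn, hsub⟩ := exists_arc_subset hN
    obtain ⟨V, hV, hVχ⟩ := exists_nhds_forall_mem_arc hU hn
    exact Filter.mem_of_superset hV fun v hv => hsub (hVχ χ hχ v hv)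
  refine continuous_iff_continuousAt.2 fun x => ?_
  have h1 : Filter.Tendsto (fun g => g - x) (𝓝 x) (𝓝 0) := by
    simpa using (continuous_sub_right x).tendsto x
  have h2 := (tendsto_const_nhds (x := χ x)).mul (h0.comp h1)
  rw [mul_one] at h2
  refine h2.congr fun g => ?_
  simp [← AddChar.map_add_eq_mul]

lemma exists_nhds_of_mem_dualGroup {t : TopologicalSpace G} {χ : AddChar G Circle}
    (hχ : χ ∈ dualGroup t) {ε : ℝ} (hε : 0 < ε) :
    ∃ U ∈ @nhds G t 0, ∀ u ∈ U, χ u ∈ arc ε := by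
  let _ := t
  have hc : Continuous (fun g => χ g) := hχ
  refine ⟨(fun g => χ g) ⁻¹' arc ε, hc.continuousAt.preimage_mem_nhds ?_, fun u hu => hu⟩
  rw [AddChar.map_zero_eq_one]
  have := isLocalHomeomorph_circleExp.isOpenMap.image_mem_nhds
    (Icc_mem_nhds (show -ε < 0 by linarith) hε)
  simpa [arc] using this

section Nfold

variable {H : Type*} [AddCommGroup H] {A : Set H}

lemma nfold_add (m n : ℕ) : nfold A (m + n) = nfold A m + nfold A n := by
  induction n with
  | zero => simp [nfold]
  | succ n ih => rw [← add_assoc, nfold, ih, nfold, add_assoc]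

lemma nfold_one : nfold A 1 = A := by simp [nfold]

lemma zero_mem_nfold (h : (0 : H) ∈ A) (n : ℕ) : (0 : H) ∈ nfold A n := by
  induction n with
  | zero => simp [nfold]
  | succ n ih => exact ⟨0, ih, 0, h, add_zero 0⟩

lemma nfold_mono (h : (0 : H) ∈ A) {m n : ℕ} (hmn : m ≤ n) : nfold A m ⊆ nfold A n := by
  obtain ⟨k, rfl⟩ := Nat.exists_eq_add_of_le hmn
  rw [nfold_add]
  exact Set.subset_add_left _ (zero_mem_nfold h k)

end Nfold

lemma IsQuasiConvex.zero_mem {t : TopologicalSpace G} {A : Set G} (hA : IsQuasiConvex t A) :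
    (0 : G) ∈ A := by
  by_contra h
  obtain ⟨χ, -, h1, -⟩ := hA 0 h
  exact h1 (by rw [AddChar.map_zero_eq_one]; exact one_mem_circlePos)

lemma mem_arc_of_mem_nfold {t : TopologicalSpace G} {K : Set (dualGroup t)} {g : G} {ε : ℝ}
    (h : ∀ χ ∈ K, (χ : AddChar G Circle) g ∈ arc ε) (n : ℕ) :
    ∀ χ ∈ nfold K n, (χ : AddChar G Circle) g ∈ arc (n * ε) := by
  induction n with
  | zero =>
    rintro χ rfl
    simpa using one_mem_arc le_rfl
  | succ n ih =>
    rintro _ ⟨a, ha, b, hb, rfl⟩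
    have hab : ((n + 1 : ℕ) : ℝ) * ε = n * ε + ε := by push_cast; ring
    rw [hab]
    exact arc_mul_mem (ih a ha) (h b hb)

/-- Evaluation at `g` as a character of the dual group. -/
def evalChar {t : TopologicalSpace G} (g : G) : AddChar (dualGroup t) Circle where
  toFun χ := (χ : AddChar G Circle) g
  map_zero_eq_one' := by simp
  map_add_eq_mul' := by simp

lemma evalChar_mem {t : TopologicalSpace G} (g : G) :
    (evalChar g : AddChar (dualGroup t) Circle) ∈ dualGroup (weakStar t) :=
  continuous_iInf_dom (i := g) continuous_induced_dom

/-- The polar of `U ⊆ G` in the dual group. -/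
def polar (t : TopologicalSpace G) (U : Set G) : Set (dualGroup t) :=
  {χ | ∀ u ∈ U, (χ : AddChar G Circle) u ∈ circlePos}

lemma isQuasiConvex_polar (t : TopologicalSpace G) (U : Set G) :
    IsQuasiConvex (weakStar t) (polar t U) := by
  intro χ hχ
  simp only [polar, Set.mem_ofPred_eq, not_forall] at hχ
  obtain ⟨u, hu, h⟩ := hχ
  exact ⟨evalChar u, evalChar_mem u, h, fun η hη => hη u hu⟩

/-- Tychonoff: the polar embeds in `G → Circle` as a closed set, because every homomorphism sending
`U` into the half circle is automatically continuous. -/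
lemma isCompact_polar {t ν : TopologicalSpace G} (hν : @IsTopologicalAddGroup G ν _)
    (hc : dualGroup ν = dualGroup t) {U : Set G} (hU : U ∈ @nhds G ν 0) : @IsCompact _ (weakStar t) (polar t U) := by
  let ι : dualGroup t → (G → Circle) := fun χ g => (χ : AddChar G Circle) g
  have hind : weakStar t = TopologicalSpace.induced ι Pi.topologicalSpace := by
    simp only [weakStar, Pi.topologicalSpace, induced_iInf, induced_compose]
    rfl
  let _ := weakStar t
  have hι : Topology.IsInducing ι := ⟨hind⟩
  rw [hι.isCompact_iff]
  have himg : ι '' polar t U = {f | f 0 = 1} ∩ (⋂ x, ⋂ y, {f | f (x + y) = f x * f y}) ∩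
      ⋂ u ∈ U, {f | f u ∈ circlePos} := by
    ext f
    constructor
    · rintro ⟨χ, hχ, rfl⟩
      refine ⟨⟨AddChar.map_zero_eq_one _, ?_⟩, ?_⟩
      · exact Set.mem_iInter₂.2 fun x y => AddChar.map_add_eq_mul _ x y
      · exact Set.mem_iInter₂.2 hχ
    · rintro ⟨⟨h0, hadd⟩, hU'⟩
      rw [Set.mem_iInter₂] at hadd hU'
      let χ : AddChar G Circle := ⟨f, h0, hadd⟩
      exact ⟨⟨χ, hc.le (mem_dualGroup_of_nhds hν hU hU')⟩, hU', rfl⟩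
  rw [himg]
  refine IsClosed.isCompact (IsClosed.inter (IsClosed.inter ?_ ?_) ?_)
  · exact isClosed_eq (continuous_apply _) continuous_const
  · exact isClosed_iInter fun x => isClosed_iInter fun y =>
      isClosed_eq (continuous_apply _) ((continuous_apply x).mul (continuous_apply y))
  · exact isClosed_biInter fun u _ => isClosed_circlePos.preimage (continuous_apply u)

lemma invPolar_nfold_add_mem_nhds {t ν : TopologicalSpace G}
    (hν : @IsTopologicalAddGroup G ν _) (hc : dualGroup ν = dualGroup t) {U : Set G}
    (hU : U ∈ @nhds G ν 0) {F : Set (dualGroup t)} (hF : F.Finite) {n : ℕ} (hn : 1 ≤ n) :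
    invPolar (nfold (polar t U) n + F) ∈ @nhds G ν 0 := by
  -- With `2 * n`, each of the `n` summands contributes at most `π / (4n)`, leaving `π / 4` for the
  -- element of `F`.
  obtain ⟨V, hV, hVχ⟩ := @exists_nhds_forall_mem_arc G _ ν hν U hU (2 * n) (by omega)
  have hF' : ∀ f ∈ F, ∃ W ∈ @nhds G ν 0, ∀ u ∈ W, (f : AddChar G Circle) u ∈ arc (π / 4) :=
    fun f _ => exists_nhds_of_mem_dualGroup (hc.ge f.2) (by positivity)
  choose! W hW hWf using hF'
  refine Filter.mem_of_superset (Filter.inter_mem hV ((Filter.biInter_mem hF).2 hW)) ?_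
  rintro g ⟨hgV, hgW⟩ _ ⟨a, ha, f, hf, rfl⟩
  rw [Set.mem_iInter₂] at hgW
  have h1 := mem_arc_of_mem_nfold (fun χ (hχ : χ ∈ polar t U) => hVχ χ hχ g hgV) n a ha
  have h2 := hWf f hf g (hgW f hf)
  have h3 := arc_mul_mem h1 h2
  rw [← AddChar.add_apply] at h3
  refine arc_pi_div_two_subset (arc_mono (le_of_eq ?_) h3)
  have : (n : ℝ) ≠ 0 := by positivity
  push_cast
  field_simp
  norm_num

lemma polar_mem_Mac {t ν : TopologicalSpace G}
    (hν : @IsTopologicalAddGroup G ν _) (hc : dualGroup ν = dualGroup t) {U : Set G}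
    (hU : U ∈ @nhds G ν 0) : polar t U ∈ Mac t := by
  refine ⟨isQuasiConvex_polar t U, isCompact_polar hν hc hU, fun F hF _ n hn η hη => ?_⟩
  rw [← hc]
  exact mem_dualGroup_of_nhds hν (invPolar_nfold_add_mem_nhds hν hc hU hF hn) hη

end Characters

/-! ### The group topology generated by a member of `Mac` -/

section MacTopology

variable {G : Type*} [AddCommGroup G] {t : TopologicalSpace G}

/-- The inverse polars of the sets `(n)C + F` form a filter basis at zero of a group topology. -/
@[reducible]
def macBasis (C : Set (dualGroup t)) (h0 : 0 ∈ C) : AddGroupFilterBasis G :=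
  addGroupFilterBasisOfComm
    {W | ∃ n : ℕ, 1 ≤ n ∧ ∃ F : Set (dualGroup t), F.Finite ∧ 0 ∈ F ∧
      W = invPolar (nfold C n + F)}
    ⟨_, 1, le_rfl, {0}, Set.finite_singleton 0, rfl, rfl⟩
    (by
      rintro _ _ ⟨n, hn, F, hF, hF0, rfl⟩ ⟨m, hm, F', hF', hF0', rfl⟩
      refine ⟨_, ⟨max n m, le_max_of_le_left hn, F ∪ F', hF.union hF', Or.inl hF0, rfl⟩, ?_⟩
      refine fun g hg => ⟨fun χ hχ => hg χ ?_, fun χ hχ => hg χ ?_⟩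
      · exact Set.add_subset_add (nfold_mono h0 (le_max_left _ _)) Set.subset_union_left hχ
      · exact Set.add_subset_add (nfold_mono h0 (le_max_right _ _)) Set.subset_union_right hχ)
    (by
      rintro _ ⟨n, hn, F, hF, hF0, rfl⟩ χ -
      rw [AddChar.map_zero_eq_one]
      exact one_mem_circlePos)
    (by
      rintro _ ⟨n, hn, F, hF, hF0, rfl⟩
      -- Doubling puts both `χ` and `χ + χ` in the new set, so each value lies in the arc `π / 4`
      -- and a product of two stays in the half circle.
      refine ⟨_, ⟨n + n, by omega, F + F, hF.add hF, ⟨0, hF0, 0, hF0, add_zero 0⟩, rfl⟩, ?_⟩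
      have key : ∀ x ∈ invPolar (nfold C (n + n) + (F + F)), ∀ χ ∈ nfold C n + F,
          (χ : AddChar G Circle) x ∈ arc (π / 4) := by
        intro x hx χ hχ
        have h1 : χ ∈ nfold C (n + n) + (F + F) :=
          Set.add_subset_add (nfold_mono h0 (by omega)) (Set.subset_add_left _ hF0) hχ
        have h2 : χ + χ ∈ nfold C (n + n) + (F + F) := by
          rw [nfold_add, add_add_add_comm]
          exact Set.add_mem_add hχ hχ
        have := mem_arc_of_pow_mem (n := 2) (by norm_num) (z := (χ : AddChar G Circle) x) (by
          intro k hk1 hk2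
          interval_cases k
          · simpa using hx χ h1
          · simpa [sq] using hx _ h2)
        convert this using 2
        norm_num
      rintro _ ⟨x, hx, y, hy, rfl⟩ χ hχ
      have := arc_mul_mem (key x hx χ hχ) (key y hy χ hχ)
      rw [← AddChar.map_add_eq_mul] at this
      exact arc_pi_div_two_subset (arc_mono (by linarith) this))
    (by
      rintro _ ⟨n, hn, F, hF, hF0, rfl⟩
      refine ⟨_, ⟨n, hn, F, hF, hF0, rfl⟩, fun g hg χ hχ => ?_⟩
      rw [AddChar.map_neg_eq_inv]
      exact inv_mem_circlePos (hg χ hχ))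

lemma mem_macBasis {C : Set (dualGroup t)} {h0 : 0 ∈ C} {W : Set G} :
    W ∈ macBasis C h0 ↔ ∃ n : ℕ, 1 ≤ n ∧ ∃ F : Set (dualGroup t), F.Finite ∧ 0 ∈ F ∧
      W = invPolar (nfold C n + F) := Iff.rfl

/-- No characters are gained, by the last clause of `Mac`; none are lost, since any `η` may be put
into `F`. -/
lemma dualGroup_macBasis_topology {C : Set (dualGroup t)} (hC : C ∈ Mac t) (h0 : 0 ∈ C) :
    dualGroup (macBasis C h0).topology = dualGroup t := by
  ext η
  constructor
  · intro hη
    obtain ⟨U, hU, hUη⟩ := exists_nhds_of_mem_dualGroup hη (ε := π / 2) (by positivity)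
    obtain ⟨_, ⟨n, hn, F, hF, hF0, rfl⟩, hsub⟩ :=
      (macBasis C h0).nhds_zero_hasBasis.mem_iff.1 hU
    exact hC.2.2 F hF hF0 n hn fun g hg => arc_pi_div_two_subset (hUη g (hsub hg))
  · intro hη
    refine mem_dualGroup_of_nhds (macBasis C h0).isTopologicalAddGroup
      ((macBasis C h0).mem_nhds_zero (mem_macBasis.2
        ⟨1, le_rfl, {0, ⟨η, hη⟩}, Set.toFinite _, by simp, rfl⟩)) fun u hu => ?_
    exact hu ⟨η, hη⟩ ⟨0, zero_mem_nfold h0 1, _, by simp, zero_add _⟩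

lemma isLQC_macBasis_topology {C : Set (dualGroup t)} (hC : C ∈ Mac t) (h0 : 0 ∈ C) :
    IsLQC (macBasis C h0).topology := by
  refine ⟨(macBasis C h0).isTopologicalAddGroup, fun U hU => ?_⟩
  obtain ⟨V, hV, hsub⟩ := (macBasis C h0).nhds_zero_hasBasis.mem_iff.1 hU
  refine ⟨V, (macBasis C h0).mem_nhds_zero hV, ?_, hsub⟩
  obtain ⟨n, hn, F, hF, hF0, rfl⟩ := hV
  intro g hg
  simp only [invPolar, Set.mem_ofPred_eq, not_forall] at hg
  obtain ⟨χ, hχ, h⟩ := hg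
  exact ⟨χ, (dualGroup_macBasis_topology hC h0).ge χ.2, h, fun a ha => ha χ hχ⟩

/-- In a Mackey group every member of `Mac` is equicontinuous. -/
lemma IsMackeyGroup.invPolar_mem_nhds (ht : IsMackeyGroup t) {C : Set (dualGroup t)}
    (hC : C ∈ Mac t) : invPolar C ∈ @nhds G t 0 := by
  have h0 : 0 ∈ C := hC.1.zero_mem
  have hle := ht.2 _ (isLQC_macBasis_topology hC h0) (dualGroup_macBasis_topology hC h0)
  refine nhds_mono hle ((macBasis C h0).mem_nhds_zero (mem_macBasis.2
    ⟨1, le_rfl, {0}, Set.finite_singleton 0, rfl, ?_⟩))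
  rw [nfold_one, Set.add_singleton]
  simp

/-- A locally quasi-convex group all of whose members of `Mac` are equicontinuous is Mackey. -/
lemma isMackeyGroup_of_invPolar_mem_nhds (ht : IsLQC t)
    (h : ∀ C ∈ Mac t, invPolar C ∈ @nhds G t 0) : IsMackeyGroup t := by
  refine ⟨ht, fun ν hν hc => ?_⟩
  have htg := ht.1
  have hνg := hν.1
  suffices h0 : @nhds G t 0 ≤ @nhds G ν 0 by
    refine le_of_nhds_le_nhds fun x => ?_
    rw [← @map_add_left_nhds_zero G t, ← @map_add_left_nhds_zero G ν]
    exact Filter.map_mono h0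
  intro U hU
  obtain ⟨V, hV, hVq, hVU⟩ := hν.2 U hU
  refine Filter.mem_of_superset (h _ (polar_mem_Mac hν.1 hc hV)) fun g hg => hVU ?_
  by_contra hgV
  obtain ⟨χ, hχ, h1, h2⟩ := hVq g hgV
  exact h1 (hg ⟨χ, hc.le hχ⟩ h2)

end MacTopology

/-! ### Characters of a normed space -/

section Normed

variable {E : Type*} [NormedAddCommGroup E] [NormedSpace ℝ E]

lemma psi_apply (f : StrongDual ℝ E) (x : E) :
    (psi E f : AddChar E Circle) x = Circle.exp (2 * π * f x) := rfl

lemma psi_mem_circlePos_of_abs_le {f : StrongDual ℝ E} {x : E} (h : |f x| ≤ 1 / 4) :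
    (psi E f : AddChar E Circle) x ∈ circlePos := by
  obtain ⟨h1, h2⟩ := abs_le.1 h
  rw [psi_apply, exp_mem_circlePos]
  exact cos_nonneg_of_mem_Icc ⟨by nlinarith [pi_pos], by nlinarith [pi_pos]⟩

/-- The character sees `f x` only modulo `1`; the upper bound `1 / 2` keeps the angle from wrapping
back into the half circle. -/
lemma psi_notMem_circlePos {f : StrongDual ℝ E} {x : E} (h1 : 1 / 4 < |f x|)
    (h2 : |f x| ≤ 1 / 2) : (psi E f : AddChar E Circle) x ∉ circlePos := by
  rw [psi_apply, exp_mem_circlePos, not_le, ← cos_abs, abs_mul, abs_of_pos two_pi_pos]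
  exact cos_neg_of_pi_div_two_lt_of_lt (by nlinarith [pi_pos]) (by nlinarith [pi_pos])

/-- Every continuous character of a real normed space lifts to a continuous linear functional. -/
lemma psi_surjective : Function.Surjective (psi E) := by
  rintro ⟨χ, hχ⟩
  have hχc : Continuous (fun x : E => χ x) := hχ
  -- Lift through the covering `ℝ → Circle`, normalized by `F 0 = 0`.
  obtain ⟨F, ⟨hF0, hF⟩, -⟩ := Circle.isCoveringMap_exp.existsUnique_continuousMap_lifts
    ⟨fun x : E => χ x, hχc⟩ 0 0 (by simp)
  have hF : ∀ x, Circle.exp (F x) = χ x := fun x => congrFun hF x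
  have hadd : ∀ x y, F (x + y) = F x + F y := by
    intro x y
    -- The additivity defect is continuous with values in the discrete group `2πℤ`, hence constant
    -- on the connected space `E`.
    let D : E → ℝ := fun x => F (x + y) - F x - F y
    have hD : Continuous D := by fun_prop
    have hmem : ∀ z, D z ∈ AddSubgroup.zmultiples (2 * π) := by
      intro z
      have h1 : Circle.exp (D z) = 1 := by
        simp [D, Circle.exp_sub, hF, AddChar.map_add_eq_mul]
      obtain ⟨n, hn⟩ := Circle.exp_eq_one.1 h1
      exact ⟨n, by simp [hn]⟩
    have hconst : D x = D 0 := by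
      have hc : Continuous fun z => (⟨D z, hmem z⟩ : AddSubgroup.zmultiples (2 * π)) :=
        hD.subtype_mk _
      exact congrArg Subtype.val (PreconnectedSpace.constant inferInstance hc (x := x) (y := 0))
    simp only [D, zero_add, hF0] at hconst
    linarith
  let f : StrongDual ℝ E :=
    (2 * π)⁻¹ • (AddMonoidHom.mk' F hadd).toRealLinearMap F.continuous
  refine ⟨f, Subtype.ext (DFunLike.ext _ _ fun x => ?_)⟩
  rw [psi_apply]
  change _ = χ x
  rw [← hF x]
  congr 1
  change 2 * π * ((2 * π)⁻¹ * F x) = F x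
  have := two_pi_pos.ne'
  field_simp

lemma isQuasiConvex_closedBall {r : ℝ} (hr : 0 < r) :
    IsQuasiConvex (normTopology E) (Metric.closedBall (0 : E) r) := by
  intro g hg
  rw [mem_closedBall_zero_iff, not_le] at hg
  obtain ⟨f, hf, hfg⟩ := exists_dual_vector'' ℝ g
  rw [RCLike.ofReal_real_eq_id, id] at hfg
  have hg0 : 0 < ‖g‖ := hr.trans hg
  -- Rescale the norming functional `f` of `g` so that it is at most `1 / 4` on the ball but lands
  -- in `(1 / 4, 1 / 2]` at `g`.
  obtain ⟨c, hc0, hcr, h1, h2⟩ :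
      ∃ c : ℝ, 0 < c ∧ c * r ≤ 1 / 4 ∧ 1 / 4 < c * ‖g‖ ∧ c * ‖g‖ ≤ 1 / 2 := by
    rcases le_total ‖g‖ (2 * r) with h | h
    · refine ⟨1 / (4 * r), by positivity, le_of_eq (by field_simp), ?_, ?_⟩
      · rw [div_mul_eq_mul_div, one_mul, lt_div_iff₀ (by positivity)]
        linarith
      · rw [div_mul_eq_mul_div, one_mul, div_le_iff₀ (by positivity)]
        linarith
    · have hval : 1 / (2 * ‖g‖) * ‖g‖ = 1 / 2 := by field_simp
      refine ⟨1 / (2 * ‖g‖), by positivity, ?_, by rw [hval]; norm_num, hval.le⟩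
      rw [div_mul_eq_mul_div, one_mul, div_le_iff₀ (by positivity)]
      linarith
  have hcg : |(c • f) g| = c * ‖g‖ := by
    rw [smul_apply, smul_eq_mul, hfg, abs_of_pos (by positivity)]
  refine ⟨psi E (c • f), (psi E (c • f)).2,
    psi_notMem_circlePos (hcg ▸ h1) (hcg ▸ h2), fun a ha => psi_mem_circlePos_of_abs_le ?_⟩
  rw [mem_closedBall_zero_iff] at ha
  have hfa : |f a| ≤ r := (f.le_of_opNorm_le hf a).trans (by linarith)
  rw [smul_apply, smul_eq_mul, abs_mul, abs_of_pos hc0]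
  exact (mul_le_mul_of_nonneg_left hfa hc0.le).trans hcr

lemma isLQC_normTopology : IsLQC (normTopology E) := by
  refine ⟨inferInstance, fun U hU => ?_⟩
  obtain ⟨r, hr, hsub⟩ := Metric.nhds_basis_closedBall.mem_iff.1 hU
  exact ⟨_, Metric.closedBall_mem_nhds 0 hr, isQuasiConvex_closedBall hr, hsub⟩

lemma isBounded_preimage_psi_iff {C : Set (dualGroup (normTopology E))} :
    Bornology.IsBounded (psi E ⁻¹' C) ↔ invPolar C ∈ 𝓝 (0 : E) := by
  constructor
  · intro h
    obtain ⟨M, hM, hb⟩ := h.exists_pos_norm_le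
    refine Filter.mem_of_superset
      (Metric.closedBall_mem_nhds (0 : E) (ε := 1 / (4 * M)) (by positivity)) fun x hx χ hχ => ?_
    obtain ⟨f, rfl⟩ := psi_surjective χ
    rw [mem_closedBall_zero_iff] at hx
    refine psi_mem_circlePos_of_abs_le ?_
    calc |f x| ≤ ‖f‖ * ‖x‖ := f.le_opNorm x
      _ ≤ M * (1 / (4 * M)) := by gcongr; exact hb f hχ
      _ = 1 / 4 := by field_simp
  · intro h
    obtain ⟨r, hr, hsub⟩ := Metric.nhds_basis_closedBall.mem_iff.1 h
    refine isBounded_iff_forall_norm_le.2 ⟨1 / 4 / r, fun f hf => ?_⟩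
    refine f.opNorm_bound_of_ball_bound hr _ fun x hx => ?_
    by_contra! hlt
    rw [Real.norm_eq_abs] at hlt
    -- If `|f x|` exceeds `1 / 4`, shrinking `x` inside the ball brings it into `(1 / 4, 1 / 2]`,
    -- where the character leaves the half circle.
    obtain ⟨s, hs, h1, h2⟩ : ∃ s : ℝ, |s| ≤ 1 ∧ 1 / 4 < |f (s • x)| ∧ |f (s • x)| ≤ 1 / 2 := by
      rcases le_total |f x| (1 / 2) with h | h
      · exact ⟨1, by simp, by simpa using hlt, by simpa using h⟩
      · have hpos : 0 < |f x| := by linarith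
        have hval : |f ((1 / 2 / |f x|) • x)| = 1 / 2 := by
          rw [map_smul, smul_eq_mul, abs_mul, abs_of_pos (by positivity)]
          field_simp
        refine ⟨1 / 2 / |f x|, ?_, by rw [hval]; norm_num, hval.le⟩
        rw [abs_of_pos (by positivity), div_le_one hpos]
        exact h
    refine psi_notMem_circlePos h1 h2 (hsub ?_ _ hf)
    rw [mem_closedBall_zero_iff] at hx ⊢
    rw [norm_smul, Real.norm_eq_abs]
    exact (mul_le_of_le_one_left (norm_nonneg x) hs).trans hx

end Normed

end MackeyGroup

end

theorem corollaryc (E : Type*) [NormedAddCommGroup E] [NormedSpace ℝ E] :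
    MackeyGroup.IsMackeyGroup (MackeyGroup.normTopology E) ↔
      ∀ C ∈ MackeyGroup.Mac (MackeyGroup.normTopology E),
        Bornology.IsBounded (MackeyGroup.psi E ⁻¹' C) := by
  simp only [MackeyGroup.isBounded_preimage_psi_iff]
  exact ⟨fun h C hC => h.invPolar_mem_nhds hC,
    MackeyGroup.isMackeyGroup_of_invPolar_mem_nhds MackeyGroup.isLQC_normTopology⟩
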